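/- Let $\mathfrak t$ be a finite-dimensional real inner product space and let $\Phi\subset\mathfrak t$ be a reduced crystallographic root system spanning $\mathfrak t$, whose Weyl group preserves the inner product $\langle\cdot,\cdot\rangle$ (for example, the roots of a compact semisimple Lie algebra $\mathfrak g$ with Cartan subalgebra $\mathfrak t$, where $\langle\cdot,\cdot\rangle$ is the restriction of an $\mathrm{Ad}$-invariant inner product, used to identify $\mathfrak t\cong\mathfrak t^*$). Let $\Phi^+$ be a choice of positive roots and $Q$ the root lattice. Call $\Phi^+$ unimodular if every subset of $\Phi^+$ that spans $\mathfrak t$ over $\mathbb R$ generates $Q$ over $\mathbb Z$. Let $B_c[\Phi^+]$ be the centered box spline, i.e. the image of Lebesgue measure on $[-\tfrac12,\tfrac12]^{\Phi^+}$ under $(t_\alpha)\mapsto\sum_{\alpha\in\Phi^+}t_\alpha\alpha$, and let $b$ be its density with respect to the Lebesgue measure $\mathrm{vol}$ on $\mathfrak t$ induced by the inner product, with pointwise values $$b(x)=\lim_{\varepsilon\to0^+}\frac{B_c[\Phi^+]\big(\bar B(x,\varepsilon)\big)}{\mathrm{vol}\big(\bar B(x,\varepsilon)\big)},$$ where $\bar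 B(x,\varepsilon)$ is the closed ball of radius $\varepsilon$ about $x$. The $R$-polynomial is $$R(x)=\sum_{\tau\in Q}b(\tau)\cos\langle\tau,x\rangle,\qquad x\in\mathfrak t.$$ Suppose that $\Phi^+$ is not unimodular. Then the limit defining $b(\tau)$ exists for every $\tau\in Q$, $b(\tau)\neq0$ for only finitely many $\tau\in Q$, and $R(x)=0$ for some $x\in\mathfrak t$. Consequently there is no universal $\ell^1$ deconvolution kernel: there is no $c\in\ell^1(Q)$, $c:Q\to\mathbb C$, such that $\sum_{\tau\in Q}c(\tau)\,b(\nu-\tau)$ equals $1$ for $\nu=0$ and $0$ for every $\nu\in Q\setminus\{0\}$. -/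

import Mathlib

open scoped InnerProductSpace Topology

noncomputable section

namespace BoxSpline

/-- The centered box spline of a finite set `X` of vectors: the image of Lebesgue measure on the
cube `[-1/2, 1/2] ^ X` under the map sending `t` to `∑ α ∈ X, t α • α`. -/
def centeredBoxSpline {V : Type*} [NormedAddCommGroup V] [InnerProductSpace ℝ V]
    [MeasurableSpace V] (X : Finset V) : MeasureTheory.Measure V :=
  MeasureTheory.Measure.map (fun t : X → ℝ => ∑ α : X, t α • (α : V))
    ((MeasureTheory.volume : MeasureTheory.Measure (X → ℝ)).restrict
      (Set.Icc (fun _ => -(1 / 2 : ℝ)) (fun _ => (1 / 2 : ℝ))))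

/-- The mean density of the centered box spline on the closed ball of radius `ε` around `x`, with
respect to the Lebesgue measure on `V` induced by its inner product. -/
def meanDensity {V : Type*} [NormedAddCommGroup V] [InnerProductSpace ℝ V]
    [FiniteDimensional ℝ V] [MeasurableSpace V] [BorelSpace V]
    (X : Finset V) (x : V) (ε : ℝ) : ℝ :=
  (centeredBoxSpline X).real (Metric.closedBall x ε) /
    (MeasureTheory.volume : MeasureTheory.Measure V).real (Metric.closedBall x ε)

/-- The density `b` of the centered box spline, defined pointwise as the limit of its mean
densities on balls shrinking to `x`. When `X` spans `V`, the box spline is absolutely continuous,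
and by Lebesgue differentiation this is a density of it; at a point near which some version of the
density is continuous, the limit exists and is the value of that continuous version. -/
def density {V : Type*} [NormedAddCommGroup V] [InnerProductSpace ℝ V]
    [FiniteDimensional ℝ V] [MeasurableSpace V] [BorelSpace V]
    (X : Finset V) (x : V) : ℝ :=
  Filter.limUnder (𝓝[>] (0 : ℝ)) (meanDensity X x)

/-- The positive roots, as a finite set of vectors, for the choice of positive roots given by the
base `B` of the root system `P`. -/
def positiveRoots {ι V N : Type*} [Finite ι] [AddCommGroup V] [Module ℝ V]
    [AddCommGroup N] [Module ℝ N] (P : RootPairing ι ℝ V N) (B : P.Base) : Finset V :=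
  (Set.toFinite (P.root '' {i | B.IsPos i})).toFinset

/-- The positive roots are unimodular: any collection of positive roots that spans the ambient
space over `ℝ` generates the root lattice over `ℤ`. -/
def IsUnimodular {ι V N : Type*} [Finite ι] [AddCommGroup V] [Module ℝ V]
    [AddCommGroup N] [Module ℝ N] (P : RootPairing ι ℝ V N) (B : P.Base) : Prop :=
  ∀ S : Set V, S ⊆ (positiveRoots P B : Set V) →
    Submodule.span ℝ S = ⊤ → Submodule.span ℤ S = P.rootSpan ℤ

/-- The `R`-polynomial `R(x) = ∑_{τ ∈ Q} b(τ) cos ⟨τ, x⟩`, with `Q` the root lattice and `b` the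
density of the centered box spline of the positive roots. -/
def rPolynomial {ι V N : Type*} [Finite ι] [NormedAddCommGroup V] [InnerProductSpace ℝ V]
    [FiniteDimensional ℝ V] [MeasurableSpace V] [BorelSpace V] [AddCommGroup N] [Module ℝ N]
    (P : RootPairing ι ℝ V N) (B : P.Base) (x : V) : ℝ :=
  ∑' τ : P.rootSpan ℤ, density (positiveRoots P B) (τ : V) * Real.cos ⟪(τ : V), x⟫_ℝ

open Classical in
/-- A deconvolution kernel: a function `c` on the root lattice `Q` whose convolution over `Q` with
the restriction of `b` to `Q` is the unit mass at `0`. -/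
def IsDeconvolutionKernel {ι V N : Type*} [Finite ι] [NormedAddCommGroup V]
    [InnerProductSpace ℝ V] [FiniteDimensional ℝ V] [MeasurableSpace V] [BorelSpace V]
    [AddCommGroup N] [Module ℝ N]
    (P : RootPairing ι ℝ V N) (B : P.Base) (c : P.rootSpan ℤ → ℂ) : Prop :=
  ∀ ν : P.rootSpan ℤ,
    ∑' τ : P.rootSpan ℤ, c τ * (density (positiveRoots P B) ((ν : V) - (τ : V)) : ℂ) =
      if ν = 0 then 1 else 0

end BoxSpline

end

/-!
The `R`-polynomial vanishes at a frequency `x` for which the character `χ τ = exp (i ⟪τ, x⟫)` is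
trivial on the lattice `L` generated by some basis `S` of `V` made of positive roots, but not on the
root lattice `Q`. Such `S` and `x` exist exactly because the positive roots are not unimodular: if
`L ≠ Q`, then a point of `Q` has a non-integral coordinate in `S`, and `x` is `2π` times the
corresponding dual basis vector (`exists_expChar_ne_one`).

The vanishing needs no Poisson summation. For a small ball `A` about `0`, the sum of
`χ τ * μ (τ + A)` over `τ ∈ Q`, with `μ` the box spline, is the integral over the cube of
`G (∑ t α • α)`, where `G w` is the sum of `χ τ` over the `τ ∈ Q` with `w ∈ τ + A`. Fix the cube
coordinates outside `S`. In the coordinates of `S`, the integrand is then periodic under the integer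
lattice, since `χ` is trivial on `L`, and translation by a suitable `q ∈ Q` multiplies it by
`χ q ≠ 1`. Its integral over the unit cube, a fundamental domain, is therefore zero
(`integral_cube_eq_zero`, `sum_char_mul_centeredBoxSpline_eq_zero`). Dividing by the volume of `A`
and letting `A` shrink gives `∑ χ τ * b τ = 0`, whose real part is `R x = 0`.

The limit defining `b` exists at the points of `Q` by dominated convergence, applied to the same
splitting of the cube with the simple roots as the basis (`exists_tendsto_meanDensity`). For almost
all values of the other coordinates the relevant point is off the boundary of the parallelepiped of
the simple roots. A point of `Q` has integral coordinates, never `±1/2`, so this also holds for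
simple roots that occur in no other positive root, the only directions in which the box spline
may have jumps.

Finally, the Fourier transform on `Q` turns the equation of an `ℓ¹` deconvolution kernel into
`0 = 1` at the character `χ` (`not_forall_tsum_mul_sub_eq_ite`).
-/

namespace BoxSpline

open MeasureTheory Module

/-! ### The cube, and box splines as iterated integrals -/

/-- The centered unit cube `[-1/2, 1/2] ^ ι`. -/
def cube (ι : Type*) : Set (ι → ℝ) := Set.Icc (fun _ : ι => -(1 / 2 : ℝ)) (fun _ : ι => (1 / 2 : ℝ))

lemma measurableSet_cube (ι : Type*) [Finite ι] : MeasurableSet (cube ι) :=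
  measurableSet_Icc

lemma mem_cube {ι : Type*} {t : ι → ℝ} : t ∈ cube ι ↔ ∀ i, |t i| ≤ 1 / 2 := by
  simp only [cube, Set.mem_Icc, Pi.le_def, abs_le]
  exact ⟨fun h i => ⟨h.1 i, h.2 i⟩, fun h => ⟨fun i => (h i).1, fun i => (h i).2⟩⟩

lemma volume_cube_ne_top (ι : Type*) [Fintype ι] : volume (cube ι) ≠ ⊤ :=
  isCompact_Icc.measure_ne_top

instance (ι : Type*) [Fintype ι] : IsFiniteMeasure (volume.restrict (cube ι)) :=
  isFiniteMeasure_restrict.2 (volume_cube_ne_top ι)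

open scoped Pointwise in
/-- On the cube, a function that is multiplied by a scalar `ζ ≠ 1` under some translation and is
invariant under translation by `ℤ ^ ι` has integral zero: its integrals over the cube and over the
translated cube agree, as both sets are fundamental domains of `ℤ ^ ι`. -/
lemma integral_cube_eq_zero {ι : Type*} [Fintype ι] (h : (ι → ℝ) → ℂ)
    (hper : ∀ n ∈ Submodule.span ℤ (Set.range (Pi.basisFun ℝ ι)), ∀ t, h (n + t) = h t)
    (a : ι → ℝ) (ζ : ℂ) (hζ : ζ ≠ 1) (ha : ∀ t, h (a + t) = ζ * h t) :
    ∫ t in cube ι, h t = 0 := by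
  set D := ZSpan.fundamentalDomain (Pi.basisFun ℝ ι) with hD
  have : Countable (Submodule.span ℤ (Set.range (Pi.basisFun ℝ ι))).toAddSubgroup :=
    inferInstanceAs (Countable (Submodule.span ℤ (Set.range (Pi.basisFun ℝ ι))))
  have hfd := ZSpan.isAddFundamentalDomain' (Pi.basisFun ℝ ι) (volume : Measure (ι → ℝ))
  have key : ∀ v : ι → ℝ, ∫ t in v +ᵥ D, h t = ∫ t in D, h t := fun v =>
    (hfd.vadd_of_comm v).setIntegral_eq hfd fun g x => hper g g.2 x
  have hshift : ∫ t in a +ᵥ D, h t = ∫ t in D, h (a + t) := by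
    rw [show a +ᵥ D = (fun t => a + t) '' D from rfl]
    exact (measurePreserving_add_left volume a).setIntegral_image_emb
      (MeasurableEquiv.addLeft a).measurableEmbedding h D
  have hzero : ∫ t in D, h t = 0 := by
    have h1 : ∫ t in D, h t = ζ * ∫ t in D, h t := by
      conv_lhs => rw [← key a, hshift]
      simp_rw [ha]
      exact integral_const_mul _ _
    have h2 : (ζ - 1) * ∫ t in D, h t = 0 := by linear_combination -h1
    exact (mul_eq_zero.1 h2).resolve_left (sub_ne_zero.2 hζ)
  have hcube : cube ι =ᵐ[volume] (fun _ : ι => -(1 / 2 : ℝ)) +ᵥ D := by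
    have : ((fun _ : ι => -(1 / 2 : ℝ)) +ᵥ D : Set (ι → ℝ)) =
        Set.univ.pi fun _ => Set.Ico (-(1 / 2 : ℝ)) (1 / 2) := by
      ext t
      rw [Set.mem_vadd_set_iff_neg_vadd_mem]
      simp only [hD, ZSpan.mem_fundamentalDomain, Pi.basisFun_repr, Set.mem_pi, Set.mem_univ,
        true_imp_iff]
      refine forall_congr' fun i => ?_
      simp only [vadd_eq_add, Pi.add_apply, Pi.neg_apply, Set.mem_Ico]
      constructor <;> rintro ⟨h1, h2⟩ <;> constructor <;> linarith
    rw [this]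
    exact (Measure.univ_pi_Ico_ae_eq_Icc (μ := fun _ : ι => (volume : Measure ℝ))).symm
  rw [setIntegral_congr_set hcube, key, hzero]

/-- The solutions of a linear equation `ℓ s = k` form a null set, unless `ℓ = 0` and `k = 0`. -/
lemma volume_setOf_linear_eq {ι : Type*} [Fintype ι] (ℓ : (ι → ℝ) →ₗ[ℝ] ℝ) (k : ℝ)
    (h : ℓ ≠ 0 ∨ k ≠ 0) : volume {s : ι → ℝ | ℓ s = k} = 0 := by
  by_cases hne : ∃ s₀, ℓ s₀ = k
  · obtain ⟨s₀, hs₀⟩ := hne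
    have hℓ : ℓ ≠ 0 := by
      rintro rfl
      simp only [ne_eq, not_true_eq_false, false_or] at h
      exact h (by simpa using hs₀.symm)
    have : {s : ι → ℝ | ℓ s = k} = (fun s => s + -s₀) ⁻¹' (LinearMap.ker ℓ : Set (ι → ℝ)) := by
      ext s
      simp [hs₀, add_neg_eq_zero]
    rw [this, measure_preimage_add_right]
    exact Measure.addHaar_submodule _ _ (by rwa [Ne, LinearMap.ker_eq_top])
  · push Not at hne
    simp [hne]

section Split

variable {V : Type*} [NormedAddCommGroup V] [InnerProductSpace ℝ V]
  [FiniteDimensional ℝ V] [MeasurableSpace V] [BorelSpace V]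
  (X : Finset V) (p : X → Prop) [DecidablePred p]

/-- Fubini for the box spline: the coordinates of the cube are split into those in `p`, which are
integrated first, and the others. -/
lemma centeredBoxSpline_apply {A : Set V} (hA : MeasurableSet A) :
    centeredBoxSpline X A = ∫⁻ s in cube {α : X // ¬ p α}, volume (cube {α : X // p α} ∩
      {t | ∑ α, t α • (α.1 : V) + ∑ β, s β • (β.1 : V) ∈ A}) := by
  have hm : Measurable fun t : X → ℝ => ∑ α : X, t α • (α : V) := by fun_prop
  rw [centeredBoxSpline, Measure.map_apply hm hA, Measure.restrict_apply (hm hA)]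
  have hmp := volume_preserving_piEquivPiSubtypeProd (fun _ : X => ℝ) p
  set W : Set (({α : X // p α} → ℝ) × ({α : X // ¬ p α} → ℝ)) :=
    {x | x.1 ∈ cube _ ∧ x.2 ∈ cube _ ∧
      ∑ α, x.1 α • (α.1 : V) + ∑ β, x.2 β • (β.1 : V) ∈ A} with hWdef
  have hW : MeasurableSet W := by
    refine (measurable_fst (measurableSet_cube _)).inter
      ((measurable_snd (measurableSet_cube _)).inter ?_)
    have : Measurable fun x : ({α : X // p α} → ℝ) × ({α : X // ¬ p α} → ℝ) =>
      ∑ α, x.1 α • (α.1 : V) + ∑ β, x.2 β • (β.1 : V) := by fun_prop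
    exact this hA
  have hpre : ((fun t : X → ℝ => ∑ α : X, t α • (α : V)) ⁻¹' A ∩
      Set.Icc (fun _ => -(1 / 2 : ℝ)) fun _ => (1 / 2 : ℝ)) =
      MeasurableEquiv.piEquivPiSubtypeProd (fun _ : X => ℝ) p ⁻¹' W := by
    ext t
    have hsum := Fintype.sum_subtype_add_sum_subtype p (fun α : X => t α • (α : V))
    have hc : t ∈ cube X ↔ (fun α : {α : X // p α} => t α) ∈ cube _ ∧
        (fun α : {α : X // ¬ p α} => t α) ∈ cube _ := by
      simp only [mem_cube]
      refine ⟨fun h => ⟨fun i => h i, fun i => h i⟩, fun h i => ?_⟩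
      by_cases hi : p i
      exacts [h.1 ⟨i, hi⟩, h.2 ⟨i, hi⟩]
    change _ ∧ t ∈ cube X ↔ (fun α : {α : X // p α} => t α) ∈ cube _ ∧
      (fun α : {α : X // ¬ p α} => t α) ∈ cube _ ∧
        ∑ α : {α : X // p α}, t α • (α.1 : V) + ∑ β : {α : X // ¬ p α}, t β • (β.1 : V) ∈ A
    rw [hsum, hc, Set.mem_preimage]
    tauto
  rw [hpre, hmp.measure_preimage hW.nullMeasurableSet, Measure.volume_eq_prod,
    Measure.prod_apply_symm hW, ← lintegral_indicator (measurableSet_cube _)]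
  refine lintegral_congr fun s => ?_
  by_cases hs : s ∈ cube {α : X // ¬ p α}
  · rw [Set.indicator_of_mem hs]
    congr 1
    ext t
    simp [hWdef, hs]
  · rw [Set.indicator_of_notMem hs]
    convert measure_empty (μ := (volume : Measure ({α : X // p α} → ℝ)))
    ext t
    simp [hWdef, hs]

lemma measurable_volume_slice {A : Set V} (hA : MeasurableSet A) :
    Measurable fun s : {α : X // ¬ p α} → ℝ => volume (cube {α : X // p α} ∩
      {t | ∑ α, t α • (α.1 : V) + ∑ β, s β • (β.1 : V) ∈ A}) := by
  have : Measurable fun x : ({α : X // p α} → ℝ) × ({α : X // ¬ p α} → ℝ) =>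
      ∑ α, x.1 α • (α.1 : V) + ∑ β, x.2 β • (β.1 : V) := by fun_prop
  exact measurable_measure_prodMk_right
    ((measurable_fst (measurableSet_cube _)).inter (this hA))

end Split

/-- A set of vectors of `X` that is a basis of `V`, as a basis indexed by a subtype of `X`. -/
lemma exists_basis_subtype {V : Type*} [AddCommGroup V] [Module ℝ V]
    (X : Finset V) (S : Set V) (hSX : S ⊆ X) (hli : LinearIndepOn ℝ id S)
    (hspan : Submodule.span ℝ S = ⊤) :
    ∃ b : Basis {α : X // (α : V) ∈ S} ℝ V, ∀ α, b α = (α.1 : V) := by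
  let e : {α : X // (α : V) ∈ S} ≃ S :=
    { toFun := fun α => ⟨α.1, α.2⟩
      invFun := fun s => ⟨⟨s, hSX s.2⟩, s.2⟩
      left_inv := fun _ => rfl
      right_inv := fun _ => rfl }
  refine ⟨(Basis.mk (v := fun s : S => (s : V)) hli (by simp [hspan])).reindex e.symm, fun α => ?_⟩
  simp only [Basis.reindex_apply, Equiv.symm_symm]
  exact Basis.mk_apply _ _ _

/-! ### Existence and support of the density -/

section Limit

variable {V : Type*} [NormedAddCommGroup V] [InnerProductSpace ℝ V]
  [FiniteDimensional ℝ V] [MeasurableSpace V] [BorelSpace V]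

/-- In the coordinates of a basis, Lebesgue measure is a multiple of the Euclidean volume. -/
lemma exists_volume_coords_eq {ι : Type*} [Fintype ι] (b : Basis ι ℝ V) :
    ∃ c : NNReal, ∀ A : Set V, MeasurableSet A →
      volume {t : ι → ℝ | ∑ i, t i • b i ∈ A} = c * volume A := by
  let e : (ι → ℝ) ≃L[ℝ] V := b.equivFun.symm.toContinuousLinearEquiv
  have : (Measure.map e (volume : Measure (ι → ℝ))).IsAddHaarMeasure :=
    e.isAddHaarMeasure_map volume
  refine ⟨Measure.addHaarScalarFactor (Measure.map e (volume : Measure (ι → ℝ))) volume,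
    fun A hA => ?_⟩
  have h := Measure.isAddLeftInvariant_eq_smul (Measure.map e (volume : Measure (ι → ℝ))) volume
  have h2 := congrArg (fun μ : Measure V => μ A) h
  rw [Measure.map_apply e.continuous.measurable hA] at h2
  refine Eq.trans ?_ h2
  congr 1
  ext t
  simp [e, Basis.equivFun_symm_apply]

/-- Mean densities converge at every point whose coordinates in some basis contained in `X` avoid
`±1/2`. With the remaining cube coordinates `s` fixed, the mean density of the parallelepiped of
the basis converges unless its center, translated by `s`, has `τ` on its boundary. That happens
only for a null set of `s`: the condition is a linear equation in `s`, and if its linear part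
vanishes then it has no solution, as it reads that a coordinate of `τ` is `±1/2`. -/
lemma exists_tendsto_meanDensity (X : Finset V) (p : X → Prop) [DecidablePred p]
    (b : Basis {α : X // p α} ℝ V) (hb : ∀ α, b α = (α.1 : V)) (τ : V)
    (hτ : ∀ i, |b.repr τ i| ≠ 1 / 2) :
    ∃ l, Filter.Tendsto (meanDensity X τ) (𝓝[>] (0 : ℝ)) (𝓝 l) := by
  obtain ⟨c, hc⟩ := exists_volume_coords_eq b
  let z : ({α : X // ¬ p α} → ℝ) → V := fun s => ∑ β, s β • (β.1 : V)
  let slice : ℝ → ({α : X // ¬ p α} → ℝ) → Set ({α : X // p α} → ℝ) := fun ε s =>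
    {t | ∑ α, t α • (α.1 : V) + ∑ β, s β • (β.1 : V) ∈ Metric.closedBall τ ε}
  let F : ℝ → ({α : X // ¬ p α} → ℝ) → ENNReal := fun ε s =>
    volume (cube {α : X // p α} ∩ slice ε s) * (volume (Metric.closedBall τ ε))⁻¹
  let u : ({α : X // ¬ p α} → ℝ) → {α : X // p α} → ℝ := fun s i => b.repr (τ - z s) i
  classical
  let f : ({α : X // ¬ p α} → ℝ) → ENNReal := fun s => if ∀ i, |u s i| < 1 / 2 then c else 0
  have hpos : ∀ ε : ℝ, 0 < ε → volume (Metric.closedBall τ ε) ≠ 0 := fun ε hε =>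
    (Metric.measure_closedBall_pos volume τ hε).ne'
  have hfin : ∀ ε : ℝ, volume (Metric.closedBall τ ε) ≠ ⊤ := fun ε =>
    measure_closedBall_lt_top.ne
  have hslice : ∀ ε s, volume (slice ε s) = c * volume (Metric.closedBall τ ε) := by
    intro ε s
    have h1 : slice ε s = {t | ∑ i, t i • b i ∈ Metric.closedBall (τ - z s) ε} := by
      ext t
      simp only [slice, z, Set.mem_ofPred_eq, hb, Metric.mem_closedBall, dist_eq_norm]
      rw [show ∀ x y w : V, x + y - w = x - (w - y) by intros; abel]
    rw [h1, hc _ Metric.isClosed_closedBall.measurableSet,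
      Measure.addHaar_closedBall_center volume (τ - z s),
      Measure.addHaar_closedBall_center volume τ]
  have hfull : ∀ ε s, 0 < ε →
      volume (slice ε s) * (volume (Metric.closedBall τ ε))⁻¹ = c := by
    intro ε s hε
    rw [hslice, mul_assoc, ENNReal.mul_inv_cancel (hpos ε hε) (hfin ε), mul_one]
  have hlim : Filter.Tendsto (fun ε => ∫⁻ s in cube {α : X // ¬ p α}, F ε s) (𝓝[>] (0 : ℝ))
      (𝓝 (∫⁻ s in cube {α : X // ¬ p α}, f s)) := by
    refine tendsto_lintegral_filter_of_dominated_convergence (fun _ => (c : ENNReal)) ?_ ?_ ?_ ?_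
    · refine Filter.Eventually.of_forall fun ε => ?_
      exact (measurable_volume_slice X p Metric.isClosed_closedBall.measurableSet).mul_const _
    · filter_upwards [self_mem_nhdsWithin] with ε hε
      refine Filter.Eventually.of_forall fun s => ?_
      rw [← hfull ε s hε]
      exact mul_le_mul_left (measure_mono Set.inter_subset_right) _
    · rw [setLIntegral_const]
      exact ENNReal.mul_ne_top ENNReal.coe_ne_top (volume_cube_ne_top _)
    · have hgood : ∀ᵐ s ∂(volume : Measure ({α : X // ¬ p α} → ℝ)), ∀ i, |u s i| ≠ 1 / 2 := by
        rw [ae_all_iff]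
        intro i
        let ℓ : ({α : X // ¬ p α} → ℝ) →ₗ[ℝ] ℝ :=
          b.coord i ∘ₗ Fintype.linearCombination ℝ (fun β : {α : X // ¬ p α} => (β.1 : V))
        have hu : ∀ s, u s i = b.repr τ i - ℓ s := by
          intro s
          simp [u, ℓ, z, Fintype.linearCombination_apply]
        have hn1 := volume_setOf_linear_eq ℓ (b.repr τ i - 1 / 2) (Or.inr fun h => hτ i (by
          rw [sub_eq_zero.1 h]; norm_num))
        have hn2 := volume_setOf_linear_eq ℓ (b.repr τ i + 1 / 2) (Or.inr fun h => hτ i (by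
          rw [eq_neg_of_add_eq_zero_left h]; norm_num))
        rw [ae_iff]
        refine measure_mono_null (fun s hs => ?_) (measure_union_null hn1 hn2)
        simp only [Set.mem_ofPred_eq, not_not, hu] at hs
        rcases (abs_eq (by norm_num)).1 hs with h | h
        · exact Or.inl (by simp only [Set.mem_ofPred_eq]; linarith)
        · exact Or.inr (by simp only [Set.mem_ofPred_eq]; linarith)
      filter_upwards [ae_restrict_of_ae hgood] with s hs
      refine tendsto_nhds_of_eventually_eq ?_
      -- A coordinate condition that is open and holds at `τ` holds on all small balls.
      have hnear : ∀ (i : {α : X // p α}) (O : Set ℝ), IsOpen O → u s i ∈ O →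
          ∀ᶠ ε in 𝓝[>] (0 : ℝ), ∀ t ∈ slice ε s, t i ∈ O := by
        intro i O hO hi
        have hcont : Continuous fun y : V => b.repr (y - z s) i :=
          (LinearMap.continuous_of_finiteDimensional (b.coord i)).comp
            (continuous_id.sub continuous_const)
        have hmem : (fun y : V => b.repr (y - z s) i) ⁻¹' O ∈ 𝓝 τ :=
          hcont.continuousAt (hO.mem_nhds hi)
        obtain ⟨δ, hδ, hsub⟩ := Metric.nhds_basis_closedBall.mem_iff.1 hmem
        filter_upwards [Ioc_mem_nhdsGT hδ] with ε hε t ht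
        have := hsub (Metric.closedBall_subset_closedBall hε.2 ht)
        rw [Set.mem_preimage] at this
        convert this using 1
        simp only [z, add_sub_cancel_right, ← hb]
        rw [b.repr_sum_self]
      by_cases hin : ∀ i, |u s i| < 1 / 2
      · have hall := Filter.eventually_all.2 fun i => hnear i {x | |x| < 1 / 2}
          (isOpen_lt continuous_abs continuous_const) (hin i)
        filter_upwards [hall, self_mem_nhdsWithin] with ε hε hε0
        have : cube {α : X // p α} ∩ slice ε s = slice ε s :=
          Set.inter_eq_right.2 fun t ht => mem_cube.2 fun i => (hε i t ht).le
        simp only [F, f, this, if_pos hin, hfull ε s hε0]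
      · have hout := hin
        push Not at hin
        obtain ⟨i, hi⟩ := hin
        filter_upwards [hnear i {x | 1 / 2 < |x|} (isOpen_lt continuous_const continuous_abs)
          (lt_of_le_of_ne hi (hs i).symm)] with ε hε
        have : cube {α : X // p α} ∩ slice ε s = ∅ := by
          refine Set.eq_empty_of_forall_notMem fun t ht => ?_
          exact absurd (mem_cube.1 ht.1 i) (not_le.2 (hε t ht.2))
        simp only [F, f, this, if_neg hout, measure_empty, zero_mul]
  have hne : ∫⁻ s in cube {α : X // ¬ p α}, f s ≠ ⊤ := by
    refine ((lintegral_mono (g := fun _ => (c : ENNReal)) fun s => ?_).trans_lt ?_).ne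
    · simp only [f]
      split_ifs <;> simp
    · rw [setLIntegral_const]
      exact ENNReal.mul_lt_top ENNReal.coe_lt_top (volume_cube_ne_top _).lt_top
  refine ⟨_, ((ENNReal.tendsto_toReal hne).comp hlim).congr' ?_⟩
  filter_upwards [self_mem_nhdsWithin] with ε hε
  simp only [Function.comp_apply, F]
  rw [lintegral_mul_const' _ _ (ENNReal.inv_ne_top.2 (hpos ε hε)),
    ← centeredBoxSpline_apply X p Metric.isClosed_closedBall.measurableSet, ENNReal.toReal_mul,
    ENNReal.toReal_inv, ← div_eq_mul_inv]
  rfl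

end Limit

section Support

lemma norm_sum_smul_le_of_mem_cube {V : Type*} [SeminormedAddCommGroup V] [NormedSpace ℝ V]
    {ι : Type*} [Fintype ι] {t : ι → ℝ} (ht : t ∈ cube ι)
    (v : ι → V) : ‖∑ i, t i • v i‖ ≤ ∑ i, ‖v i‖ := by
  refine norm_sum_le_of_le _ fun i _ => ?_
  rw [norm_smul, Real.norm_eq_abs]
  exact mul_le_of_le_one_left (norm_nonneg _) ((mem_cube.1 ht i).trans (by norm_num))

variable {V : Type*} [NormedAddCommGroup V] [InnerProductSpace ℝ V]
  [FiniteDimensional ℝ V] [MeasurableSpace V] [BorelSpace V] (X : Finset V)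

lemma centeredBoxSpline_closedBall_eq_zero {τ : V} {ε : ℝ}
    (h : ∑ α : X, ‖(α : V)‖ + ε < ‖τ‖) :
    centeredBoxSpline X (Metric.closedBall τ ε) = 0 := by
  have hm : Measurable fun t : X → ℝ => ∑ α : X, t α • (α : V) := by fun_prop
  rw [centeredBoxSpline, Measure.map_apply hm Metric.isClosed_closedBall.measurableSet,
    Measure.restrict_apply (hm Metric.isClosed_closedBall.measurableSet)]
  convert measure_empty (μ := (volume : Measure (X → ℝ)))
  refine Set.eq_empty_of_forall_notMem fun t ht => ?_
  have h1 := norm_sum_smul_le_of_mem_cube (show t ∈ cube X from ht.2) (fun α : X => (α : V))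
  have h2 : dist _ τ ≤ ε := ht.1
  rw [dist_comm, dist_eq_norm] at h2
  have h3 := norm_sub_norm_le τ (∑ α : X, t α • (α : V))
  linarith

lemma density_eq_zero {τ : V} (h : ∑ α : X, ‖(α : V)‖ < ‖τ‖) :
    density X τ = 0 := by
  refine Filter.Tendsto.limUnder_eq (tendsto_nhds_of_eventually_eq ?_)
  filter_upwards [Ioo_mem_nhdsGT (sub_pos.2 h)] with ε hε
  have := centeredBoxSpline_closedBall_eq_zero X (τ := τ) (ε := ε) (by linarith [hε.2])
  simp [meanDensity, Measure.real, this]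

end Support

/-! ### Vanishing of character sums of the density -/

section Vanishing

variable {V : Type*} [NormedAddCommGroup V] [InnerProductSpace ℝ V]
  [FiniteDimensional ℝ V] [MeasurableSpace V] [BorelSpace V]

/-- A character that is trivial on a basis `b` but not on a larger lattice `Q`, summed against
the box splines of small balls around the points of `Q`, gives exactly zero. For fixed values of
the other cube coordinates, the sum is the integral over the cube of a function that is periodic
under the lattice of `b` and is multiplied by `χ q` under translation by `q ∈ Q`. -/
lemma sum_char_mul_centeredBoxSpline_eq_zero (X : Finset V) (p : X → Prop) [DecidablePred p]
    (b : Basis {α : X // p α} ℝ V) (hb : ∀ α, b α = (α.1 : V)) (Q : Submodule ℤ V)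
    (χ : AddChar V ℂ) (hbQ : ∀ i, b i ∈ Q) (hχb : ∀ i, χ (b i) = 1)
    {q : V} (hq : q ∈ Q) (hχq : χ q ≠ 1) (F : Finset Q) {ε : ℝ}
    (hF : ∀ τ : Q, τ ∉ F → ∑ α : X, ‖(α : V)‖ + ε < ‖(τ : V)‖) :
    ∑ τ ∈ F, χ τ * ((centeredBoxSpline X).real (Metric.closedBall (τ : V) ε) : ℂ) = 0 := by
  let y : ({α : X // p α} → ℝ) → ({α : X // ¬ p α} → ℝ) → V := fun t s =>
    ∑ α, t α • (α.1 : V) + ∑ β, s β • (β.1 : V)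
  let slice : V → ({α : X // ¬ p α} → ℝ) → Set ({α : X // p α} → ℝ) := fun τ s =>
    {t | y t s ∈ Metric.closedBall τ ε}
  have hball : ∀ τ : V, MeasurableSet (Metric.closedBall τ ε) := fun τ =>
    Metric.isClosed_closedBall.measurableSet
  have hslice : ∀ τ s, MeasurableSet (slice τ s) := by
    intro τ s
    have : Measurable fun t => y t s := by fun_prop
    exact this (hball τ)
  have hlt : ∀ τ s, volume (cube {α : X // p α} ∩ slice τ s) < ⊤ := fun τ s =>
    (measure_mono Set.inter_subset_left).trans_lt (volume_cube_ne_top _).lt_top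
  have hmeas : ∀ τ, Measurable fun s => volume (cube {α : X // p α} ∩ slice τ s) := fun τ =>
    measurable_volume_slice X p (hball τ)
  have hreal : ∀ τ : V, (centeredBoxSpline X).real (Metric.closedBall τ ε) =
      ∫ s in cube {α : X // ¬ p α}, volume.real (cube {α : X // p α} ∩ slice τ s) := by
    intro τ
    rw [Measure.real, centeredBoxSpline_apply X p (hball τ)]
    exact (integral_toReal (hmeas τ).aemeasurable (ae_of_all _ (hlt τ))).symm
  have hint : ∀ τ : V, IntegrableOn (fun s => (volume.real (cube {α : X // p α} ∩ slice τ s) : ℂ))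
      (cube {α : X // ¬ p α}) := by
    intro τ
    refine Integrable.ofReal (Integrable.of_bound (C := volume.real (cube {α : X // p α}))
      (hmeas τ).ennreal_toReal.aestronglyMeasurable (ae_of_all _ fun s => ?_))
    change ‖volume.real (cube {α : X // p α} ∩ slice τ s)‖ ≤ _
    rw [Real.norm_of_nonneg measureReal_nonneg]
    exact measureReal_mono Set.inter_subset_left (volume_cube_ne_top _)
  have hpoint : ∀ s ∈ cube {α : X // ¬ p α},
      ∑ τ ∈ F, χ τ * (volume.real (cube {α : X // p α} ∩ slice (τ : V) s) : ℂ) = 0 := by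
    intro s hs
    let G : V → ℂ := fun w =>
      ∑' τ : Q, χ τ * (Metric.closedBall (τ : V) ε).indicator (fun _ => (1 : ℂ)) w
    have hG : ∀ a ∈ Q, ∀ w, G (a + w) = χ a * G w := by
      intro a ha w
      simp only [G]
      rw [← (Equiv.addLeft (⟨a, ha⟩ : Q)).tsum_eq, ← tsum_mul_left]
      refine tsum_congr fun τ => ?_
      simp only [Equiv.coe_addLeft, Submodule.coe_add, AddChar.map_add_eq_mul, mul_assoc]
      congr 2
      simp [Set.indicator, Metric.mem_closedBall, dist_eq_norm]
    have hyadd : ∀ n t, y (n + t) s = ∑ α, n α • (α.1 : V) + y t s := by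
      intro n t
      simp only [y, Pi.add_apply, add_smul, Finset.sum_add_distrib, add_assoc]
    have hzero : ∫ t in cube {α : X // p α}, G (y t s) = 0 := by
      refine integral_cube_eq_zero _ (fun n hn t => ?_) (b.equivFun q) (χ q) hχq fun t => ?_
      · have hn' : ∑ α, n α • (α.1 : V) ∈ Q ∧ χ (∑ α, n α • (α.1 : V)) = 1 := by
          induction hn using Submodule.span_induction with
          | mem x hx =>
            obtain ⟨i, rfl⟩ := hx
            have : ∑ α, (Pi.basisFun ℝ {α : X // p α} i) α • (α.1 : V) = b i := by
              classical
              rw [hb]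
              simp [Pi.single_apply, ite_smul]
            rw [this]
            exact ⟨hbQ i, hχb i⟩
          | zero => simp
          | add x x' _ _ h h' =>
            simp only [Pi.add_apply, add_smul, Finset.sum_add_distrib]
            exact ⟨Q.add_mem h.1 h'.1, by rw [AddChar.map_add_eq_mul, h.2, h'.2, one_mul]⟩
          | smul k x _ h =>
            have : ∑ α, (k • x) α • (α.1 : V) = k • ∑ α, x α • (α.1 : V) := by
              simp only [Pi.smul_apply, Finset.smul_sum, smul_assoc]
            rw [this]
            exact ⟨Q.smul_mem k h.1, by rw [AddChar.map_zsmul_eq_zpow, h.2, one_zpow]⟩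
        rw [hyadd, hG _ hn'.1, hn'.2, one_mul]
      · have : ∑ α, b.equivFun q α • (α.1 : V) = q := by
          simp_rw [← hb]
          exact b.sum_equivFun q
        rw [hyadd, this, hG q hq]
    rw [← hzero]
    have hcongr : ∫ t in cube {α : X // p α}, G (y t s) = ∫ t in cube {α : X // p α},
        ∑ τ ∈ F, χ τ * (slice (τ : V) s).indicator (fun _ => (1 : ℂ)) t := by
      refine setIntegral_congr_fun (measurableSet_cube _) fun t ht => ?_
      refine tsum_eq_sum fun τ hτ => ?_
      rw [Set.indicator_of_notMem, mul_zero]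
      intro hmem
      have h1 := norm_sum_smul_le_of_mem_cube ht (fun α : {α : X // p α} => (α.1 : V))
      have h2 := norm_sum_smul_le_of_mem_cube hs (fun α : {α : X // ¬ p α} => (α.1 : V))
      have h3 := Fintype.sum_subtype_add_sum_subtype p (fun α : X => ‖(α : V)‖)
      have h4 := norm_add_le (∑ α : {α : X // p α}, t α • (α.1 : V))
        (∑ β : {α : X // ¬ p α}, s β • (β.1 : V))
      have h5 : dist (y t s) τ ≤ ε := hmem
      rw [dist_comm, dist_eq_norm] at h5
      have h6 := norm_sub_norm_le (τ : V) (y t s)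
      have h7 := hF τ hτ
      simp only [y] at h5 h6
      linarith
    rw [hcongr, integral_finsetSum _ fun τ _ => ?_]
    · refine Finset.sum_congr rfl fun τ _ => ?_
      rw [integral_const_mul, integral_indicator_const _ (hslice _ _),
        measureReal_restrict_apply (hslice _ _), Set.inter_comm]
      simp
    · exact ((integrable_const (1 : ℂ)).indicator (hslice _ _)).const_mul _
  calc ∑ τ ∈ F, χ τ * ((centeredBoxSpline X).real (Metric.closedBall (τ : V) ε) : ℂ)
      = ∑ τ ∈ F, ∫ s in cube {α : X // ¬ p α},
          χ τ * (volume.real (cube {α : X // p α} ∩ slice (τ : V) s) : ℂ) := by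
        refine Finset.sum_congr rfl fun τ _ => ?_
        rw [hreal, integral_const_mul, integral_complex_ofReal]
    _ = ∫ s in cube {α : X // ¬ p α}, ∑ τ ∈ F,
          χ τ * (volume.real (cube {α : X // p α} ∩ slice (τ : V) s) : ℂ) :=
        (integral_finsetSum F fun τ _ => (hint (τ : V)).const_mul (χ τ)).symm
    _ = 0 := by
        rw [setIntegral_congr_fun (measurableSet_cube _) hpoint]
        simp

/-- The vanishing of the character sum, in the limit of balls shrinking to the lattice points. -/
lemma sum_char_mul_density_eq_zero (X : Finset V) (p : X → Prop) [DecidablePred p]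
    (b : Basis {α : X // p α} ℝ V) (hb : ∀ α, b α = (α.1 : V)) (Q : Submodule ℤ V)
    (χ : AddChar V ℂ) (hbQ : ∀ i, b i ∈ Q) (hχb : ∀ i, χ (b i) = 1)
    {q : V} (hq : q ∈ Q) (hχq : χ q ≠ 1) (F : Finset Q)
    (hF : ∀ τ : Q, τ ∉ F → ∑ α : X, ‖(α : V)‖ + 1 < ‖(τ : V)‖)
    (hlim : ∀ τ ∈ Q, Filter.Tendsto (meanDensity X τ) (𝓝[>] (0 : ℝ)) (𝓝 (density X τ))) :
    ∑ τ ∈ F, χ τ * (density X (τ : V) : ℂ) = 0 := by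
  have h1 : Filter.Tendsto (fun ε => ∑ τ ∈ F, χ τ * (meanDensity X (τ : V) ε : ℂ)) (𝓝[>] (0 : ℝ))
      (𝓝 (∑ τ ∈ F, χ τ * (density X (τ : V) : ℂ))) :=
    tendsto_finsetSum _ fun τ _ =>
      ((Complex.continuous_ofReal.tendsto _).comp (hlim τ τ.2)).const_mul _
  refine tendsto_nhds_unique h1 (tendsto_nhds_of_eventually_eq ?_)
  filter_upwards [Ioc_mem_nhdsGT one_pos] with ε hε
  have h2 := sum_char_mul_centeredBoxSpline_eq_zero X p b hb Q χ hbQ hχb hq hχq F (ε := ε)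
    fun τ hτ => by linarith [hF τ hτ, hε.2]
  have h3 : ∀ τ : V, (volume : Measure V).real (Metric.closedBall τ ε) =
      (volume : Measure V).real (Metric.closedBall 0 ε) := fun τ => by
    rw [Measure.real, Measure.real, Measure.addHaar_closedBall_center]
  calc ∑ τ ∈ F, χ τ * (meanDensity X (τ : V) ε : ℂ)
      = (∑ τ ∈ F, χ τ * ((centeredBoxSpline X).real (Metric.closedBall (τ : V) ε) : ℂ)) *
        ((volume : Measure V).real (Metric.closedBall 0 ε) : ℂ)⁻¹ := by
        rw [Finset.sum_mul]
        refine Finset.sum_congr rfl fun τ _ => ?_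
        rw [meanDensity, h3 τ]
        push_cast
        ring
    _ = 0 := by rw [h2, zero_mul]

end Vanishing

section Character

variable {V : Type*} [NormedAddCommGroup V] [InnerProductSpace ℝ V]

/-- The character `τ ↦ exp (i ⟪τ, x⟫)` of `V` with frequency `x`. -/
noncomputable def expChar (x : V) : AddChar V ℂ where
  toFun τ := Complex.exp (⟪τ, x⟫_ℝ * Complex.I)
  map_zero_eq_one' := by simp
  map_add_eq_mul' τ σ := by
    rw [inner_add_left, Complex.ofReal_add, add_mul, Complex.exp_add]

lemma expChar_apply (x τ : V) : expChar x τ = Complex.exp (⟪τ, x⟫_ℝ * Complex.I) := rfl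

lemma norm_expChar (x τ : V) : ‖expChar x τ‖ = 1 :=
  Complex.norm_exp_ofReal_mul_I _

lemma expChar_re (x τ : V) : (expChar x τ).re = Real.cos ⟪τ, x⟫_ℝ :=
  Complex.exp_ofReal_mul_I_re _

/-- A vector outside the lattice of a basis has a non-integral coordinate, and `2π` times the
corresponding dual basis vector is the frequency of a character separating it from the lattice. -/
lemma exists_expChar_ne_one [FiniteDimensional ℝ V] {ι : Type*} [Finite ι] (b : Basis ι ℝ V)
    {q : V} (hq : q ∉ Submodule.span ℤ (Set.range b)) :
    ∃ x : V, (∀ i, expChar x (b i) = 1) ∧ expChar x q ≠ 1 := by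
  classical
  have hcoord : ∃ i, ∀ n : ℤ, b.repr q i ≠ n := by
    by_contra! h
    refine hq ((b.mem_span_iff_repr_mem ℤ q).2 fun i => ?_)
    obtain ⟨n, hn⟩ := h i
    exact ⟨n, by simp [hn]⟩
  obtain ⟨i, hi⟩ := hcoord
  let x : V := (InnerProductSpace.toDual ℝ V).symm
    ((2 * Real.pi) • LinearMap.toContinuousLinearMap (b.coord i))
  have hx : ∀ v : V, ⟪v, x⟫_ℝ = 2 * Real.pi * b.repr v i := by
    intro v
    rw [real_inner_comm, InnerProductSpace.toDual_symm_apply]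
    simp
  refine ⟨x, fun j => ?_, fun h => ?_⟩
  · rw [expChar_apply, hx, Complex.exp_eq_one_iff]
    refine ⟨if j = i then 1 else 0, ?_⟩
    rw [b.repr_self, Finsupp.single_apply]
    split_ifs <;> simp
  · rw [expChar_apply, hx, Complex.exp_eq_one_iff] at h
    obtain ⟨n, hn⟩ := h
    refine hi n ?_
    have h2 : ((2 * Real.pi * b.repr q i : ℝ) : ℂ) * Complex.I =
        ((2 * Real.pi * n : ℝ) : ℂ) * Complex.I := by
      rw [hn]
      push_cast
      ring
    have h3 := Complex.ofReal_injective (mul_right_cancel₀ Complex.I_ne_zero h2)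
    exact mul_left_cancel₀ (by positivity) h3

end Character

/-- A finitely supported function on an abelian group whose Fourier transform vanishes at some
character has no convolution inverse in `ℓ¹`. -/
lemma not_forall_tsum_mul_sub_eq_ite {Q : Type*} [AddCommGroup Q] (χ : AddChar Q ℂ)
    (hχ : ∀ τ, ‖χ τ‖ = 1) (f : Q → ℂ) (F : Finset Q) (hF : ∀ τ, τ ∉ F → f τ = 0)
    (hsum : ∑ τ ∈ F, χ τ * f τ = 0) (c : Q → ℂ) (hc : Summable fun τ => ‖c τ‖) :
    ¬ ∀ ν, ∑' τ, c τ * f (ν - τ) = open Classical in if ν = 0 then 1 else 0 := by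
  classical
  intro h
  have hconv : ∀ ν, ∑' τ, c τ * f (ν - τ) = ∑ σ ∈ F, c (ν - σ) * f σ := by
    intro ν
    rw [← (Equiv.subLeft ν).tsum_eq]
    simp only [Equiv.subLeft_apply, sub_sub_cancel]
    exact tsum_eq_sum fun σ hσ => by rw [hF σ hσ, mul_zero]
  have hcχ : Summable fun ν => χ ν * c ν :=
    Summable.of_norm (by simpa [hχ] using hc)
  have hcσ : ∀ σ, Summable fun ν => χ (ν - σ) * c (ν - σ) := fun σ =>
    (Equiv.subRight σ).summable_iff.2 hcχ
  have h1 : ∑' ν, χ ν * ∑' τ, c τ * f (ν - τ) = 1 := by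
    rw [tsum_eq_single 0 fun ν hν => by rw [h ν, if_neg hν, mul_zero], h 0]
    simp
  have h2 : ∑' ν, χ ν * ∑' τ, c τ * f (ν - τ) = 0 := by
    have hterm : ∀ ν, χ ν * ∑' τ, c τ * f (ν - τ) =
        ∑ σ ∈ F, χ (ν - σ) * c (ν - σ) * (χ σ * f σ) := by
      intro ν
      rw [hconv, Finset.mul_sum]
      refine Finset.sum_congr rfl fun σ _ => ?_
      have : χ ν = χ (ν - σ) * χ σ := by rw [← AddChar.map_add_eq_mul, sub_add_cancel]
      rw [this]
      ring
    simp_rw [hterm]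
    rw [Summable.tsum_finsetSum fun σ _ => (hcσ σ).mul_right _]
    have hshift : ∀ σ, ∑' ν, χ (ν - σ) * c (ν - σ) * (χ σ * f σ) =
        (∑' ν, χ ν * c ν) * (χ σ * f σ) := by
      intro σ
      rw [tsum_mul_right]
      congr 1
      exact (Equiv.subRight σ).tsum_eq fun ν => χ ν * c ν
    simp_rw [hshift, ← Finset.mul_sum, hsum, mul_zero]
  exact one_ne_zero (h1.symm.trans h2)

/-! ### Positive roots and the zero of the `R`-polynomial -/

section RootSystem

variable {ι V N : Type*} [Finite ι] [AddCommGroup V] [Module ℝ V] [AddCommGroup N] [Module ℝ N]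
  {P : RootPairing ι ℝ V N} (B : P.Base)

lemma positiveRoots_subset_rootSpan : (positiveRoots P B : Set V) ⊆ P.rootSpan ℤ := by
  intro v hv
  simp only [positiveRoots, Set.Finite.coe_toFinset] at hv
  obtain ⟨i, -, rfl⟩ := hv
  exact Submodule.subset_span (Set.mem_range_self i)

lemma simpleRoots_subset_positiveRoots :
    P.root '' B.support ⊆ (positiveRoots P B : Set V) := by
  simp only [positiveRoots, Set.Finite.coe_toFinset]
  exact Set.image_mono fun i hi => B.isPos_of_mem_support hi

/-- If the positive roots are not unimodular, some of them form a basis of the ambient space that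
generates a proper sublattice of the root lattice. -/
lemma exists_basis_span_ne_of_not_isUnimodular (hB : ¬ IsUnimodular P B) :
    ∃ S : Set V, S ⊆ (positiveRoots P B : Set V) ∧ LinearIndepOn ℝ id S ∧
      Submodule.span ℝ S = ⊤ ∧ ∃ q ∈ P.rootSpan ℤ, q ∉ Submodule.span ℤ S := by
  simp only [IsUnimodular, not_forall] at hB
  obtain ⟨T, hT, hspan, hne⟩ := hB
  obtain ⟨S, hST, hS, hli⟩ := exists_linearIndependent ℝ T
  refine ⟨S, hST.trans hT, hli, hS.trans hspan, ?_⟩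
  by_contra! h
  exact hne (le_antisymm
    (Submodule.span_le.2 (hT.trans (positiveRoots_subset_rootSpan B)))
    fun q hq => Submodule.span_mono hST (h q hq))

end RootSystem

end BoxSpline

open BoxSpline in
theorem proposition5p6 {ι V N : Type*} [Finite ι]
    [NormedAddCommGroup V] [InnerProductSpace ℝ V] [FiniteDimensional ℝ V]
    [MeasurableSpace V] [BorelSpace V] [AddCommGroup N] [Module ℝ N]
    (P : RootPairing ι ℝ V N) [P.IsRootSystem] [P.IsCrystallographic] [P.IsReduced]
    (hW : ∀ (i : ι) (x y : V), ⟪P.reflection i x, P.reflection i y⟫_ℝ = ⟪x, y⟫_ℝ)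
    (B : P.Base) (hB : ¬ BoxSpline.IsUnimodular P B) :
    -- `b` is well defined at the points of the root lattice, and nonzero at finitely many of them
    (∀ τ ∈ P.rootSpan ℤ,
      Filter.Tendsto (BoxSpline.meanDensity (BoxSpline.positiveRoots P B) τ) (𝓝[>] (0 : ℝ))
        (𝓝 (BoxSpline.density (BoxSpline.positiveRoots P B) τ))) ∧
    {τ : P.rootSpan ℤ | BoxSpline.density (BoxSpline.positiveRoots P B) (τ : V) ≠ 0}.Finite ∧
    -- the `R`-polynomial has a zero
    (∃ x : V, BoxSpline.rPolynomial P B x = 0) ∧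
    -- there is no deconvolution kernel in `ℓ¹`
    ¬ ∃ c : P.rootSpan ℤ → ℂ, Memℓp c 1 ∧ BoxSpline.IsDeconvolutionKernel P B c := by
  classical
  set X := positiveRoots P B
  -- The simple roots give coordinates in which the root lattice is integral.
  have hsimple : Submodule.span ℤ (P.root '' B.support) = P.rootSpan ℤ := B.span_int_root_support
  obtain ⟨b₀, hb₀⟩ := exists_basis_subtype X (P.root '' B.support)
    (simpleRoots_subset_positiveRoots B) B.linearIndepOn_root.id_image
    (B.span_root_support.trans RootPairing.IsRootSystem.span_root_eq_top)
  have hrange : ∀ (S : Set V), S ⊆ X → ∀ b : Module.Basis {α : X // (α : V) ∈ S} ℝ V,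
      (∀ α, b α = (α.1 : V)) → Set.range b = S := by
    intro S hS b hb
    ext v
    constructor
    · rintro ⟨α, rfl⟩
      rw [hb]
      exact α.2
    · exact fun hv => ⟨⟨⟨v, hS hv⟩, hv⟩, hb _⟩
  have hQ₀ : Submodule.span ℤ (Set.range b₀) = P.rootSpan ℤ := by
    rw [hrange _ (simpleRoots_subset_positiveRoots B) b₀ hb₀, hsimple]
  have hlim : ∀ τ ∈ P.rootSpan ℤ,
      Filter.Tendsto (meanDensity X τ) (𝓝[>] (0 : ℝ)) (𝓝 (density X τ)) := by
    intro τ hτ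
    refine tendsto_nhds_limUnder (exists_tendsto_meanDensity X _ b₀ hb₀ τ fun i h => ?_)
    rw [← hQ₀, b₀.mem_span_iff_repr_mem ℤ τ] at hτ
    obtain ⟨n, hn⟩ := hτ i
    rw [← hn] at h
    have h2 : (2 * |n| : ℤ) = 1 := by
      have : (2 * |(n : ℝ)|) = 1 := by
        rw [show |(n : ℝ)| = 1 / 2 from h]
        norm_num
      exact_mod_cast this
    omega
  have hfin : {τ : P.rootSpan ℤ | ‖(τ : V)‖ ≤ ∑ α : X, ‖(α : V)‖ + 1}.Finite := by
    have h := ZSpan.setFinite_inter b₀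
      (Metric.isBounded_closedBall (x := (0 : V)) (r := ∑ α : X, ‖(α : V)‖ + 1))
    rw [hQ₀] at h
    refine (h.preimage Subtype.val_injective.injOn).subset fun τ hτ => ?_
    exact ⟨mem_closedBall_zero_iff.2 hτ, τ.2⟩
  have hF : ∀ τ : P.rootSpan ℤ, τ ∉ hfin.toFinset →
      ∑ α : X, ‖(α : V)‖ + 1 < ‖(τ : V)‖ := by
    intro τ hτ
    simpa using hτ
  have hsupp : ∀ τ : P.rootSpan ℤ, τ ∉ hfin.toFinset → density X (τ : V) = 0 := fun τ hτ =>
    density_eq_zero X (by linarith [hF τ hτ])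
  -- A character that is trivial on the roots in `S` but not on the root lattice.
  obtain ⟨S, hSX, hli, hspan, q, hq, hqS⟩ := exists_basis_span_ne_of_not_isUnimodular B hB
  obtain ⟨b, hb⟩ := exists_basis_subtype X S hSX hli hspan
  obtain ⟨x, hx, hxq⟩ := exists_expChar_ne_one b (by rwa [hrange S hSX b hb] : q ∉ _)
  have hsum : ∑ τ ∈ hfin.toFinset, expChar x τ * (density X (τ : V) : ℂ) = 0 :=
    sum_char_mul_density_eq_zero X _ b hb (P.rootSpan ℤ) (expChar x)
      (fun i => hb i ▸ positiveRoots_subset_rootSpan B i.1.2) hx hq hxq _ hF hlim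
  refine ⟨hlim, ?_, ⟨x, ?_⟩, ?_⟩
  · refine hfin.toFinset.finite_toSet.subset fun τ hτ => ?_
    by_contra h
    exact hτ (hsupp τ h)
  · rw [rPolynomial, tsum_eq_sum fun τ hτ => by rw [hsupp τ hτ, zero_mul]]
    have h := congrArg Complex.re hsum
    rw [Complex.re_sum, Complex.zero_re] at h
    rw [← h]
    refine Finset.sum_congr rfl fun τ _ => ?_
    rw [Complex.re_mul_ofReal, expChar_re, mul_comm]
  · rintro ⟨c, hc, hker⟩
    refine not_forall_tsum_mul_sub_eq_ite
      ((expChar x).compAddMonoidHom (P.rootSpan ℤ).subtype.toAddMonoidHom)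
      (fun τ => norm_expChar x τ) (fun τ => (density X (τ : V) : ℂ)) hfin.toFinset
      (fun τ hτ => by rw [hsupp τ hτ, Complex.ofReal_zero]) hsum c ?_ fun ν => ?_
    · simpa using (memℓp_gen_iff (by norm_num)).1 hc
    · refine Eq.trans ?_ ((hker ν).trans ?_)
      · rfl
      -- The two conditionals differ in their decidability instances only.
      · congr
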